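/- Let $n\ge 0$, let $\psi:\mathbb{Q}_2\to\mathbb{C}^\times$ be an additive character of conductor $1$ (that is, $c=1$ is the smallest integer such that $\psi$ is trivial on $2^{c}\mathbb{Z}_2$), and let $\mathcal W=\mathcal X\oplus\mathcal Y$ be the symplectic space $\mathbb{Q}_2^{2n}$ with symplectic basis $e_1,\dots,e_n$ of $\mathcal X$, $f_1,\dots,f_n$ of $\mathcal Y$, so $Q(e_i,f_j)=\delta_{ij}$. Let $V=S(\mathcal Y)$ be the space of locally constant, compactly supported functions $\mathcal Y=\mathbb{Q}_2^n\to\mathbb{C}$, on which the Heisenberg group $H(\mathcal W)=\mathcal W\times\mathbb{Q}_2$, with product $(u,s)(v,t)=(u+v,\,s+t+Q(u,v))$, acts by $$(\rho(x+y,t)\phi)(y_0)=\psi\big(t-Q(x,y+2y_0)\big)\,\phi(y+y_0)\qquad(x\in\mathcal X,\ y,y_0\in\mathcal Y).$$ Let $\pi:G\to\mathrm{Sp}(\mathcal W)=\mathrm{Sp}_{2n}(\mathbb{Q}_2)$ be a two-fold central extension that carries the Weil representation $\omega:G\to\mathrm{GL}(V)$ attached to $\psi$: a linear representation with $\omega(g)\rho(v,t)=\rho(\pi(g)v,t)\omega(g)$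 for all $g\in G$, $(v,t)\in H(\mathcal W)$. For a root $\alpha$ of type $C_n$ let $X_\alpha$ be the root vector $$X_{\lambda_i-\lambda_j}=\begin{pmatrix}E_{ij}&0\\0&-E_{ji}\end{pmatrix}\ (i\ne j),\qquad X_{\lambda_i+\lambda_j}=\begin{pmatrix}0&E_{ij}+E_{ji}\\0&0\end{pmatrix}\ (i<j),\qquad X_{2\lambda_i}=\begin{pmatrix}0&E_{ii}\\0&0\end{pmatrix},\qquad X_{-\alpha}={}^tX_\alpha .$$ The positive short roots are $\lambda_i\pm\lambda_j$ with $i<j$, and the positive long roots are $2\lambda_i$. Let $J\subset G$ be the full inverse image under $\pi$ of the group of all $g\in\mathrm{Sp}_{2n}(\mathbb{Z}_2)$ whose reduction modulo $2$ lies in the Borel subgroup $B'$ of $\mathrm{O}_{2n}(\mathbb{F}_2)\subset\mathrm{Sp}_{2n}(\mathbb{F}_2)$ (the orthogonal group of $q(x,y)=\sum_i x_iy_i$) that corresponds to the positive roots; over $\mathbb{F}_2$, $B'$ is the group generated by the elements $1+tX_\alpha$, $\alpha$ positive short, $t\in\mathbb{F}_2$. Let $\mathbf f=\phi_0\otimes\cdots\otimes\phi_0\in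 V$, where $\phi_0$ is the characteristic function of $\mathbb{Z}_2$. Then the elements $1+tX_\alpha$ have unique lifts $x_\alpha(t)\in G$ such that $t\mapsto x_\alpha(t)$ is a homomorphism $\mathbb{Q}_2\to G$ for every root $\alpha$. The group $J$ acts on the line $\mathbb{C}\mathbf f$, so that there is a unique character $\bar\chi:J\to\mathbb{C}^\times$ with $\omega(j)\mathbf f=\bar\chi(j)\mathbf f$ for all $j\in J$. Moreover: 1. for every positive long root $\alpha$ and every $t\in2\mathbb{Z}_2$, $x_\alpha(t)\in J$ and $\bar\chi(x_\alpha(t))=1$; 2. for every positive long root $\alpha$ and every $t\in2\mathbb{Z}_2$, $x_\alpha(-1)x_{-\alpha}(t)x_\alpha(1)\in J$ and $\bar\chi\big(x_\alpha(-1)x_{-\alpha}(t)x_\alpha(1)\big)=\psi(-t/4)$; 3. $V^{J,\bar\chi}=\{\phi\in V:\omega(j)\phi=\bar\chi(j)\phi\text{ for all }j\in J\}=\mathbb{C}\mathbf f$. -/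

import Mathlib

noncomputable section

namespace WeilType

open Matrix

/-! ### Additive characters and Schwartz functions -/

/-- `ψ` has conductor `c`: `c` is the smallest integer such that `ψ` is trivial on
`2 ^ c ℤ_2 = {x | ‖x‖ ≤ 2 ^ (-c)}`. -/
def HasConductor (ψ : AddChar ℚ_[2] ℂ) (c : ℤ) : Prop :=
  IsLeast {m : ℤ | ∀ x : ℚ_[2], ‖x‖ ≤ (2 : ℝ) ^ (-m) → ψ x = 1} c

theorem HasConductor.isLocallyConstant {ψ : AddChar ℚ_[2] ℂ} {c : ℤ} (hψ : HasConductor ψ c) :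
    IsLocallyConstant ψ := by
  rw [IsLocallyConstant.iff_eventually_eq]
  intro x
  have hpos : (0 : ℝ) < (2 : ℝ) ^ (-c) := by positivity
  filter_upwards [Metric.closedBall_mem_nhds x hpos] with y hy
  have h1 : ψ (y - x) = 1 := hψ.1 _ (by simpa [dist_eq_norm] using hy)
  have h2 : ψ y = ψ (y - x) * ψ x := by rw [← AddChar.map_add_eq_mul, sub_add_cancel]
  rw [h2, h1, one_mul]

/-- The Schwartz space `S(𝒴)`, `𝒴 = ℚ_2 ^ n`: locally constant, compactly supported functions. -/
def Schwartz (n : ℕ) : Submodule ℂ ((Fin n → ℚ_[2]) → ℂ) where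
  carrier := {φ | IsLocallyConstant φ ∧ HasCompactSupport φ}
  zero_mem' := ⟨IsLocallyConstant.const 0, HasCompactSupport.zero⟩
  add_mem' := fun ha hb => ⟨ha.1.add hb.1, ha.2.add hb.2⟩
  smul_mem' := fun c _ ha => ⟨ha.1.comp (fun z => c * z), ha.2.smul_left (f := fun _ => c)⟩

/-- `φ_m`, the characteristic function of `2 ^ m ℤ_2`. -/
def phi (m : ℤ) (y : ℚ_[2]) : ℂ :=
  if ‖y‖ ≤ (2 : ℝ) ^ (-m) then 1 else 0

theorem phi_isLocallyConstant (m : ℤ) : IsLocallyConstant (phi m) := by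
  have hpos : (0 : ℝ) < (2 : ℝ) ^ (-m) := by positivity
  have hc : IsClopen {y : ℚ_[2] | ‖y‖ ≤ (2 : ℝ) ^ (-m)} := by
    have h := IsUltrametricDist.isClopen_closedBall (0 : ℚ_[2]) hpos.ne'
    simpa [Metric.closedBall, dist_eq_norm] using h
  rw [IsLocallyConstant.iff_eventually_eq]
  intro x
  by_cases hx : x ∈ {y : ℚ_[2] | ‖y‖ ≤ (2 : ℝ) ^ (-m)}
  · filter_upwards [hc.isOpen.mem_nhds hx] with y hy
    exact (if_pos hy).trans (if_pos hx).symm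
  · filter_upwards [hc.compl.isOpen.mem_nhds hx] with y hy
    exact (if_neg hy).trans (if_neg hx).symm

/-- `f = φ_0 ⊗ ⋯ ⊗ φ_0`, as an element of `S(𝒴)`. -/
def fzero (n : ℕ) : Schwartz n :=
  ⟨fun y => ∏ i, phi 0 (y i), by
    refine ⟨?_, ?_⟩
    · rw [IsLocallyConstant.iff_eventually_eq]
      intro x
      have h : ∀ i : Fin n, ∀ᶠ y in nhds x, phi 0 (y i) = phi 0 (x i) := fun i =>
        ((phi_isLocallyConstant 0).comp_continuous
          (continuous_apply i : Continuous fun y : Fin n → ℚ_[2] => y i)).eventually_eq x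
      filter_upwards [Filter.eventually_all.2 h] with y hy
      exact Finset.prod_congr rfl fun i _ => hy i
    · refine HasCompactSupport.intro (isCompact_closedBall (0 : Fin n → ℚ_[2]) 1) fun y hy => ?_
      have h : ∃ i, ¬ ‖y i‖ ≤ 1 := by
        by_contra! hcon
        exact hy (by simpa using (pi_norm_le_iff_of_nonneg zero_le_one).2 hcon)
      obtain ⟨i, hi⟩ := h
      refine Finset.prod_eq_zero (Finset.mem_univ i) ?_
      exact if_neg (by simpa using hi)⟩

/-! ### The symplectic space, the Heisenberg group and its Schrödinger representation -/

/-- The space `𝒲 = 𝒳 + 𝒴` in coordinates of a symplectic basis: `Sum.inl i` is the coordinate of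
`e_i ∈ 𝒳` and `Sum.inr i` is the coordinate of `f_i ∈ 𝒴`. -/
abbrev SympSpace (n : ℕ) : Type := Fin n ⊕ Fin n → ℚ_[2]

/-- The symplectic form, `Q(e_i, f_j) = δ_ij`. -/
def sympForm {n : ℕ} (u v : SympSpace n) : ℚ_[2] :=
  ∑ i, (u (Sum.inl i) * v (Sum.inr i) - u (Sum.inr i) * v (Sum.inl i))

/-- The Heisenberg group `H(𝒲) = 𝒲 × ℚ_2`. -/
@[ext] structure Heisenberg (n : ℕ) where
  vec : SympSpace n
  cen : ℚ_[2]

namespace Heisenberg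

variable {n : ℕ}

instance : Mul (Heisenberg n) :=
  ⟨fun a b => ⟨a.vec + b.vec, a.cen + b.cen + sympForm a.vec b.vec⟩⟩
instance : One (Heisenberg n) := ⟨⟨0, 0⟩⟩
instance : Inv (Heisenberg n) := ⟨fun a => ⟨-a.vec, -a.cen⟩⟩

@[simp] theorem mul_vec (a b : Heisenberg n) : (a * b).vec = a.vec + b.vec := rfl
@[simp] theorem mul_cen (a b : Heisenberg n) :
    (a * b).cen = a.cen + b.cen + sympForm a.vec b.vec := rfl
@[simp] theorem one_vec : (1 : Heisenberg n).vec = 0 := rfl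
@[simp] theorem one_cen : (1 : Heisenberg n).cen = 0 := rfl
@[simp] theorem inv_vec (a : Heisenberg n) : (a⁻¹).vec = -a.vec := rfl
@[simp] theorem inv_cen (a : Heisenberg n) : (a⁻¹).cen = -a.cen := rfl

instance : Group (Heisenberg n) :=
  Group.ofLeftAxioms
    (fun a b c => by
      ext1
      · simp [add_assoc]
      · have : sympForm a.vec b.vec + sympForm (a.vec + b.vec) c.vec
            = sympForm b.vec c.vec + sympForm a.vec (b.vec + c.vec) := by
          simp only [sympForm, ← Finset.sum_add_distrib]
          exact Finset.sum_congr rfl fun i _ => by simp only [Pi.add_apply]; ring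
        simp only [mul_cen, mul_vec]
        linear_combination this)
    (fun a => by ext1 <;> simp [sympForm])
    (fun a => by
      ext1
      · simp
      · have : sympForm (-a.vec) a.vec = 0 :=
          Finset.sum_eq_zero fun i _ => by simp only [Pi.neg_apply]; ring
        simp [this])

/-- The action `g (v, t) = (g v, t)` of the symplectic group on the Heisenberg group. -/
def act (g : symplecticGroup (Fin n) ℚ_[2]) (a : Heisenberg n) : Heisenberg n :=
  ⟨(g : Matrix (Fin n ⊕ Fin n) (Fin n ⊕ Fin n) ℚ_[2]) *ᵥ a.vec, a.cen⟩

end Heisenberg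

/-- The Schrödinger model on `S(𝒴)` of the representation `ρ` of the Heisenberg group with central
character `ψ`: for `x ∈ 𝒳` and `y ∈ 𝒴`,
`(ρ(x + y, t) φ)(y₀) = ψ(t - Q(x, y + 2 y₀)) φ(y + y₀)`. -/
def schrodinger (n : ℕ) {ψ : AddChar ℚ_[2] ℂ} {c : ℤ} (hψ : HasConductor ψ c) :
    Representation ℂ (Heisenberg n) (Schwartz n) where
  toFun a :=
    { toFun := fun φ =>
        ⟨fun y₀ => ψ (a.cen - ∑ i, a.vec (Sum.inl i) * (a.vec (Sum.inr i) + 2 * y₀ i)) *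
            φ.1 (fun i => a.vec (Sum.inr i) + y₀ i), by
          have h1 : IsLocallyConstant fun y₀ : Fin n → ℚ_[2] =>
              ψ (a.cen - ∑ i, a.vec (Sum.inl i) * (a.vec (Sum.inr i) + 2 * y₀ i)) :=
            hψ.isLocallyConstant.comp_continuous (f := fun y₀ : Fin n → ℚ_[2] =>
              a.cen - ∑ i, a.vec (Sum.inl i) * (a.vec (Sum.inr i) + 2 * y₀ i)) (by fun_prop)
          have h2 : IsLocallyConstant fun y₀ : Fin n → ℚ_[2] =>
              φ.1 (fun i => a.vec (Sum.inr i) + y₀ i) :=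
            φ.2.1.comp_continuous (f := fun y₀ : Fin n → ℚ_[2] =>
              fun i => a.vec (Sum.inr i) + y₀ i) (by fun_prop)
          have h3 : HasCompactSupport fun y₀ : Fin n → ℚ_[2] =>
              φ.1 (fun i => a.vec (Sum.inr i) + y₀ i) :=
            φ.2.2.comp_homeomorph (Homeomorph.addLeft fun i => a.vec (Sum.inr i))
          exact ⟨h1.mul h2, h3.mul_left⟩⟩
      map_add' := fun φ φ' => by
        ext y₀
        exact mul_add _ _ _
      map_smul' := fun z φ => by
        ext y₀
        exact mul_left_comm _ _ _ }
  map_one' := by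
    ext φ y₀
    simp
  map_mul' a b := by
    ext φ y₀
    change ψ _ * φ.1 _ = ψ _ * (ψ _ * φ.1 _)
    rw [← mul_assoc, ← AddChar.map_add_eq_mul]
    congr 2
    · simp only [Heisenberg.mul_cen, Heisenberg.mul_vec, sympForm, Pi.add_apply]
      have : ∀ s t u v w : ℚ_[2], u - v = - w → s + t + u - v = s + t - w := by
        intro s t u v w h; linear_combination h
      rw [sub_add_sub_comm, ← Finset.sum_add_distrib]
      apply this
      rw [← Finset.sum_sub_distrib, ← Finset.sum_neg_distrib]
      exact Finset.sum_congr rfl fun i _ => by ring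
    · refine congrArg φ.1 (funext fun i => ?_)
      simp only [Heisenberg.mul_vec, Pi.add_apply]
      ring

/-! ### Central extensions and the Weil representation -/

/-- `π : G → Sp(𝒲)` is a two-fold central extension. -/
structure IsTwoFoldCentralExtension {n : ℕ} {G : Type*} [Group G]
    (π : G →* symplecticGroup (Fin n) ℚ_[2]) : Prop where
  surjective : Function.Surjective π
  central : π.ker ≤ Subgroup.center G
  card_ker : Nat.card π.ker = 2

/-- `ω` is the Schrödinger model of the Weil representation: a linear representation of `G` on
`S(𝒴)` in which each `ω(g)` is an operator `T` intertwining `ρ` and its twist by `π(g)`,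
`T ∘ ρ(h) = ρ(π(g) h) ∘ T`. -/
def IsWeilRepresentation {n : ℕ} {G : Type*} [Group G] {ψ : AddChar ℚ_[2] ℂ} {c : ℤ}
    (hψ : HasConductor ψ c) (π : G →* symplecticGroup (Fin n) ℚ_[2])
    (ω : Representation ℂ G (Schwartz n)) : Prop :=
  ∀ (g : G) (a : Heisenberg n),
    ω g ∘ₗ schrodinger n hψ a = schrodinger n hψ (Heisenberg.act (π g) a) ∘ₗ ω g

/-! ### Roots of type `C_n` and root elements -/

/-- The roots of `𝔰𝔭_{2n}`. -/
inductive Root (n : ℕ) : Type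
  /-- `λ_i - λ_j`, `i ≠ j` -/
  | sub (i j : Fin n) (h : i ≠ j) : Root n
  /-- `λ_i + λ_j`, `i < j` -/
  | add (i j : Fin n) (h : i < j) : Root n
  /-- `-(λ_i + λ_j)`, `i < j` -/
  | negAdd (i j : Fin n) (h : i < j) : Root n
  /-- `2 λ_i` -/
  | long (i : Fin n) : Root n
  /-- `-2 λ_i` -/
  | negLong (i : Fin n) : Root n

/-- The positive short roots: `λ_i ± λ_j` with `i < j`. -/
def Root.IsPosShort {n : ℕ} : Root n → Prop
  | .sub i j _ => i < j
  | .add _ _ _ => True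
  | .negAdd _ _ _ => False
  | .long _ => False
  | .negLong _ => False

/-- The root vector `X_α`. -/
def Root.X {n : ℕ} (R : Type*) [CommRing R] : Root n → Matrix (Fin n ⊕ Fin n) (Fin n ⊕ Fin n) R
  | .sub i j _ => fromBlocks (single i j 1) 0 0 (-single j i 1)
  | .add i j _ => fromBlocks 0 (single i j 1 + single j i 1) 0 0
  | .negAdd i j _ => fromBlocks 0 0 (single i j 1 + single j i 1) 0
  | .long i => fromBlocks 0 (single i i 1) 0 0
  | .negLong i => fromBlocks 0 0 (single i i 1) 0

/-- `x_α(t) = 1 + t X_α`, an element of the symplectic group over `R`. -/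
def Root.elt {n : ℕ} {R : Type*} [CommRing R] (α : Root n) (t : R) :
    symplecticGroup (Fin n) R :=
  ⟨1 + t • α.X R, by
    rw [SymplecticGroup.mem_iff, J]
    cases α with
    | sub i j h =>
      simp [Root.X, ← fromBlocks_one, fromBlocks_smul, fromBlocks_add, fromBlocks_transpose,
        fromBlocks_multiply, mul_add, add_mul, h, h.symm]
    | add i j h =>
      simp [Root.X, ← fromBlocks_one, fromBlocks_smul, fromBlocks_add, fromBlocks_transpose,
        fromBlocks_multiply]
      abel
    | negAdd i j h =>
      simp [Root.X, ← fromBlocks_one, fromBlocks_smul, fromBlocks_add, fromBlocks_transpose,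
        fromBlocks_multiply]
      abel
    | long i =>
      simp [Root.X, ← fromBlocks_one, fromBlocks_smul, fromBlocks_add, fromBlocks_transpose,
        fromBlocks_multiply]
    | negLong i =>
      simp [Root.X, ← fromBlocks_one, fromBlocks_smul, fromBlocks_add, fromBlocks_transpose,
        fromBlocks_multiply]⟩

/-- `x` is a family of lifts to `G` of the root elements: for each root `α`, a homomorphism
`t ↦ x_α(t)` from the additive group `ℚ_2` to `G` that lifts `t ↦ 1 + t X_α`. -/
def IsRootLift {n : ℕ} {G : Type*} [Group G] (π : G →* symplecticGroup (Fin n) ℚ_[2])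
    (x : Root n → (Multiplicative ℚ_[2] →* G)) : Prop :=
  ∀ (α : Root n) (t : ℚ_[2]), π (x α (Multiplicative.ofAdd t)) = α.elt t

/-! ### The group `J` -/

/-- The homomorphism of symplectic groups induced by a homomorphism of rings. -/
def sympMap (n : ℕ) {R S : Type*} [CommRing R] [CommRing S] (f : R →+* S) :
    symplecticGroup (Fin n) R →* symplecticGroup (Fin n) S where
  toFun g := ⟨g.1.map f, SymplecticGroup.map_mem g.2 f⟩
  map_one' := Subtype.ext (Matrix.map_one f f.map_zero f.map_one)
  map_mul' _ _ := Subtype.ext Matrix.map_mul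

/-- The quadratic form `q(x, y) = ∑ x_i y_i` over `𝔽_2`. -/
def quadF2 {n : ℕ} (v : Fin n ⊕ Fin n → ZMod 2) : ZMod 2 :=
  ∑ i, v (Sum.inl i) * v (Sum.inr i)

/-- The finite orthogonal group `O_{2n}(𝔽_2)` of `q`, inside `Sp_{2n}(𝔽_2)`. -/
def orthF2 (n : ℕ) : Subgroup (symplecticGroup (Fin n) (ZMod 2)) where
  carrier := {g | ∀ v : Fin n ⊕ Fin n → ZMod 2, quadF2 (g.1 *ᵥ v) = quadF2 v}
  one_mem' := fun v => by
    change quadF2 ((1 : Matrix (Fin n ⊕ Fin n) (Fin n ⊕ Fin n) (ZMod 2)) *ᵥ v) = _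
    rw [one_mulVec]
  mul_mem' := fun {a b} ha hb v => by
    change quadF2 ((a.1 * b.1) *ᵥ v) = _
    rw [← mulVec_mulVec, ha, hb]
  inv_mem' := fun {a} ha v => by
    have h : a.1 * (a⁻¹).1 = 1 := congrArg Subtype.val (mul_inv_cancel a)
    rw [← ha, mulVec_mulVec, h, one_mulVec]

/-- The Borel subgroup `B'` of `O_{2n}(𝔽_2)` that corresponds to the positive roots. Its maximal
torus has only the trivial `𝔽_2`-point, so that `B'` is its own unipotent radical, the group
generated by the positive short root groups. -/
def borelF2 (n : ℕ) : Subgroup (symplecticGroup (Fin n) (ZMod 2)) :=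
  Subgroup.closure {g | ∃ (α : Root n) (t : ZMod 2), α.IsPosShort ∧ g = α.elt t}

theorem borelF2_le_orthF2 (n : ℕ) : borelF2 n ≤ orthF2 n := by
  rw [borelF2, Subgroup.closure_le]
  rintro g ⟨α, t, hα, rfl⟩ v
  change (1 + t • α.X (ZMod 2)) ∈ {M : Matrix _ _ (ZMod 2) | quadF2 (M *ᵥ v) = quadF2 v}
  have hq : ∀ w : Fin n ⊕ Fin n → ZMod 2,
      quadF2 w = (fun i => w (Sum.inl i)) ⬝ᵥ (fun i => w (Sum.inr i)) := fun _ => rfl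
  have hv : v = Sum.elim (fun i => v (Sum.inl i)) (fun i => v (Sum.inr i)) := by
    ext (i | i) <;> rfl
  generalize (fun i => v (Sum.inl i)) = a at hv
  generalize (fun i => v (Sum.inr i)) = b at hv
  subst hv
  have h2 : (2 : ZMod 2) = 0 := rfl
  cases α with
  | sub i j h =>
    simp [hq, Root.X, add_mulVec, smul_mulVec, fromBlocks_mulVec, single_mulVec_eq, neg_mulVec]
    simp only [dotProduct, add_mul, mul_add, Finset.sum_add_distrib]
    simp [Pi.single_apply, h.symm]
    linear_combination t * a j * b i * h2
  | add i j h =>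
    simp [hq, Root.X, add_mulVec, smul_mulVec, fromBlocks_mulVec, single_mulVec_eq]
    simp only [dotProduct, add_mul, mul_add, Finset.sum_add_distrib]
    simp [Pi.single_apply]
    linear_combination t * b i * b j * h2
  | negAdd i j h => exact hα.elim
  | long i => exact hα.elim
  | negLong i => exact hα.elim

/-- `J̲`: the elements of `Sp_{2n}(ℤ_2)` whose reduction modulo 2 lies in `B'`, as a subgroup of
`Sp_{2n}(ℚ_2)`. -/
def linJ (n : ℕ) : Subgroup (symplecticGroup (Fin n) ℚ_[2]) :=
  ((borelF2 n).comap (sympMap n (PadicInt.toZMod (p := 2)))).map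
    (sympMap n (PadicInt.Coe.ringHom (p := 2)))

/-- `J`: the full inverse image of `J̲` in `G`. -/
def groupJ {n : ℕ} {G : Type*} [Group G] (π : G →* symplecticGroup (Fin n) ℚ_[2]) :
    Subgroup G :=
  (linJ n).comap π

/-- `V^{H,χ}`, the subspace on which `H` acts through `χ`. -/
def isotypic {G V : Type*} [Group G] [AddCommGroup V] [Module ℂ V] (ω : Representation ℂ G V)
    (H : Subgroup G) (χ : H →* ℂˣ) : Submodule ℂ V where
  carrier := {v | ∀ h : H, ω h v = (χ h : ℂ) • v}
  zero_mem' := fun h => by simp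
  add_mem' := fun {a b} ha hb h => by rw [map_add, ha h, hb h, smul_add]
  smul_mem' := fun z a ha h => by rw [map_smul, ha h, smul_comm]

end WeilType

end

noncomputable section

namespace WeilType

open Matrix

/-! ### Integrality in `ℚ_2` and characters of conductor one -/

/-! The lattice `ℤ_2 ^ 2n` acts on `f` by `v ↦ ψ(-q(v))`, where `q(x, y) = ∑ x_i y_i`, and `f` spans
the vectors with this behaviour (`schrodinger_fzero`, `eq_smul_fzero_of_schrodinger`). Since `ψ` is
trivial on `2ℤ_2`, only `q` modulo 2 matters. Elements of `J` preserve the lattice and, as `B' ≤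
O_{2n}(𝔽_2)`, also `q` modulo 2; hence they preserve the line of `f` (`rep_fzero`). So does a lift
`w` of the symplectic matrix `J`, which turns `q` into `-q`.

Two lifts of one element differ by a central element of order at most 2, so they have the same
square. As `ℚ_2` is 2-divisible, squares of lifts of `1 + (t/2) X_α` give the unique lifted root
groups. By Schur's lemma (`exists_eq_smul_of_commute`) and a scaling argument, `x_{2λ_i}(t)` is
exactly multiplication by `ψ(t y_i²)` (`long_apply`). Conjugation by `w` carries `x_{-2λ_i}(t)` to
`x_{2λ_i}(-t)`.

The remaining claims are about supports. The vector `w x_{2λ_i}(1) f` lives on `y_i ∈ 1/2 + ℤ_2`,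
where `ψ(-t y_i²)` is constantly `ψ(-t/4)` for `t ∈ 2ℤ_2` (`rep_negLong`). If `φ` transforms under
`J` as `f` does, the long roots force `φ` and `ω(w)φ` to be supported on `ℤ_2 ^ n`; the second
condition makes `φ` invariant under `ℤ_2 ^ n`, so `φ` is a multiple of `f` (`isotypic_charJ`). -/

theorem norm_le_half_of_lt_one {x : ℚ_[2]} (hx : ‖x‖ < 1) : ‖x‖ ≤ 1 / 2 := by
  have := (Padic.norm_le_pow_iff_norm_lt_pow_add_one x (-1)).2 (by simpa using hx)
  simpa using this

theorem norm_two : ‖(2 : ℚ_[2])‖ = 1 / 2 := by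
  simpa using Padic.norm_p (p := 2)

theorem norm_coe_le_half_iff (x : ℤ_[2]) : ‖(x : ℚ_[2])‖ ≤ 1 / 2 ↔ PadicInt.toZMod x = 0 := by
  rw [← RingHom.mem_ker, PadicInt.ker_toZMod, IsLocalRing.mem_maximalIdeal, PadicInt.mem_nonunits,
    PadicInt.norm_def]
  exact ⟨fun h => h.trans_lt (by norm_num), norm_le_half_of_lt_one⟩

theorem norm_sub_one_le_half {x : ℚ_[2]} (hx : ‖x‖ = 1) : ‖x - 1‖ ≤ 1 / 2 := by
  obtain ⟨x, rfl⟩ : ∃ z : ℤ_[2], (z : ℚ_[2]) = x := ⟨⟨x, hx.le⟩, rfl⟩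
  have h0 : PadicInt.toZMod x ≠ 0 := fun h => by
    have := (norm_coe_le_half_iff x).2 h
    rw [hx] at this
    norm_num at this
  have h1 : PadicInt.toZMod x = 1 := by
    revert h0
    generalize PadicInt.toZMod x = z
    revert z
    decide
  have := (norm_coe_le_half_iff (x - 1)).2 (by rw [map_sub, h1, map_one, sub_self])
  simpa using this

theorem padic_norm_sub_le_max (x y : ℚ_[2]) : ‖x - y‖ ≤ max ‖x‖ ‖y‖ := by
  rw [sub_eq_add_neg, ← norm_neg y]
  exact IsUltrametricDist.norm_add_le_max _ _

theorem norm_sq_sub_self_le_half {x : ℚ_[2]} (hx : ‖x‖ ≤ 1) : ‖x ^ 2 - x‖ ≤ 1 / 2 := by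
  have e : x ^ 2 - x = x * (x - 1) := by ring
  rw [e, norm_mul]
  rcases hx.lt_or_eq with h | h
  · have h1 : ‖x - 1‖ ≤ 1 :=
      (padic_norm_sub_le_max x 1).trans (by simpa using hx)
    have := mul_le_mul (norm_le_half_of_lt_one h) h1 (norm_nonneg _) (by norm_num)
    simpa using this
  · rw [h, one_mul]
    exact norm_sub_one_le_half h

theorem norm_two_mul_coe_le (s : ℤ_[2]) : ‖2 * (s : ℚ_[2])‖ ≤ 1 / 2 := by
  rw [norm_mul, norm_two]
  have : ‖(s : ℚ_[2])‖ ≤ 1 := s.2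
  linarith

namespace HasConductor

variable {ψ : AddChar ℚ_[2] ℂ}

theorem map_eq_one (hψ : HasConductor ψ 1) {x : ℚ_[2]} (hx : ‖x‖ ≤ 1 / 2) : ψ x = 1 :=
  hψ.1 x (by simpa using hx)

theorem map_eq_of_sub (hψ : HasConductor ψ 1) {x y : ℚ_[2]} (h : ‖x - y‖ ≤ 1 / 2) :
    ψ x = ψ y := by
  rw [← sub_add_cancel x y, AddChar.map_add_eq_mul, hψ.map_eq_one h, one_mul]

/-- The square of `ψ(1)` is `ψ(2) = 1`. If `ψ(1)` were 1, then `ψ` would be trivial on `ℤ_2 = 2ℤ_2 ∪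
(1 + 2ℤ_2)`, against the minimality of the conductor. -/
theorem map_one (hψ : HasConductor ψ 1) : ψ 1 = -1 := by
  have h2 : ψ 1 * ψ 1 = 1 := by
    rw [← AddChar.map_add_eq_mul]
    exact hψ.map_eq_one (by norm_num [norm_two])
  refine (mul_self_eq_one_iff.1 h2).resolve_left fun h1 => ?_
  have h0 : (0 : ℤ) ∈ {m : ℤ | ∀ x : ℚ_[2], ‖x‖ ≤ (2 : ℝ) ^ (-m) → ψ x = 1} := by
    intro x hx
    replace hx : ‖x‖ ≤ 1 := by simpa using hx
    rcases hx.lt_or_eq with h | h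
    · exact hψ.map_eq_one (norm_le_half_of_lt_one h)
    · rw [hψ.map_eq_of_sub (norm_sub_one_le_half h), h1]
  exact absurd (hψ.2 h0) (by norm_num)

/-- `2ℤ_2` is the orthogonal of `ℤ_2` with respect to `ψ`. -/
theorem norm_le_half_of_forall (hψ : HasConductor ψ 1) {z : ℚ_[2]}
    (h : ∀ x : ℚ_[2], ‖x‖ ≤ 1 → ψ (x * z) = 1) : ‖z‖ ≤ 1 / 2 := by
  refine norm_le_half_of_lt_one (lt_of_not_ge fun hz => ?_)
  have hz0 : z ≠ 0 := fun h0 => by simp [h0] at hz; linarith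
  -- If `z ∉ 2ℤ_2`, then `z⁻¹` is integral and detects `ψ(1) = -1`.
  have := h z⁻¹ (by rw [norm_inv]; exact inv_le_one_of_one_le₀ hz)
  rw [inv_mul_cancel₀ hz0, hψ.map_one] at this
  norm_num at this

theorem map_sq (hψ : HasConductor ψ 1) {x : ℚ_[2]} (hx : ‖x‖ ≤ 1) : ψ (x ^ 2) = ψ x :=
  hψ.map_eq_of_sub (norm_sq_sub_self_le_half hx)

end HasConductor

/-! ### The commutant of the Schrödinger representation -/

section Schrodinger

variable {n : ℕ} {ψ : AddChar ℚ_[2] ℂ}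

theorem schrodinger_apply {c : ℤ} (hψ : HasConductor ψ c) (a : Heisenberg n) (φ : Schwartz n)
    (y : Fin n → ℚ_[2]) :
    (schrodinger n hψ a φ).1 y =
      ψ (a.cen - ∑ i, a.vec (Sum.inl i) * (a.vec (Sum.inr i) + 2 * y i)) *
        φ.1 (fun i => a.vec (Sum.inr i) + y i) := rfl

theorem schrodinger_inl {c : ℤ} (hψ : HasConductor ψ c) (x : Fin n → ℚ_[2]) (φ : Schwartz n)
    (y : Fin n → ℚ_[2]) :
    (schrodinger n hψ ⟨Sum.elim x 0, 0⟩ φ).1 y = ψ (-(2 * ∑ i, x i * y i)) * φ.1 y := by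
  rw [schrodinger_apply]
  simp [Finset.mul_sum, mul_left_comm]

theorem schrodinger_inr {c : ℤ} (hψ : HasConductor ψ c) (x : Fin n → ℚ_[2]) (φ : Schwartz n)
    (y : Fin n → ℚ_[2]) :
    (schrodinger n hψ ⟨Sum.elim 0 x, 0⟩ φ).1 y = φ.1 (x + y) := by
  rw [schrodinger_apply]
  simp
  rfl

/-- The operator `1 + ρ(x)` kills the part of `φ` where the character of `x` is `-1`, but doubles
the value of `A φ` at 0, where that character is 1. Applying it for each `x ∈ s` reduces `φ` to
zero. -/
theorem apply_zero_eq_zero_of_finset {c : ℤ} (hψ : HasConductor ψ c)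
    (A : Schwartz n →ₗ[ℂ] Schwartz n)
    (hA : ∀ a φ, A (schrodinger n hψ a φ) = schrodinger n hψ a (A φ))
    (s : Finset (Fin n → ℚ_[2])) :
    ∀ φ : Schwartz n, (∀ y, φ.1 y ≠ 0 → ∃ x ∈ s, ψ (-(2 * ∑ i, x i * y i)) = -1) →
      (A φ).1 0 = 0 := by
  classical
  induction s using Finset.induction_on with
  | empty =>
    intro φ h
    have : φ = 0 := by
      ext y
      by_contra hy
      simpa using h y hy
    simp [this]
  | insert x s _ ih =>
    intro φ h
    have key := ih (φ + schrodinger n hψ ⟨Sum.elim x 0, 0⟩ φ) fun y hy => by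
      change φ.1 y + (schrodinger n hψ ⟨Sum.elim x 0, 0⟩ φ).1 y ≠ 0 at hy
      rw [schrodinger_inl] at hy
      obtain ⟨x', hx', h'⟩ := h y (fun h0 => hy (by rw [h0]; ring))
      rcases Finset.mem_insert.1 hx' with rfl | hs
      · exact absurd (by rw [h']; ring) hy
      · exact ⟨x', hs, h'⟩
    rw [map_add, hA] at key
    change (A φ).1 0 + (schrodinger n hψ ⟨Sum.elim x 0, 0⟩ (A φ)).1 0 = 0 at key
    rw [schrodinger_inl] at key
    simp only [Pi.zero_apply, mul_zero, Finset.sum_const_zero, neg_zero, AddChar.map_zero_eq_one,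
      one_mul] at key
    exact self_eq_neg.1 (eq_neg_of_add_eq_zero_left key)

/-- The support of `φ` is compact and misses 0, so finitely many of the open sets where a character
of `𝒳` equals `-1` cover it. -/
theorem apply_zero_eq_zero (hψ : HasConductor ψ 1) (A : Schwartz n →ₗ[ℂ] Schwartz n)
    (hA : ∀ a φ, A (schrodinger n hψ a φ) = schrodinger n hψ a (A φ))
    (φ : Schwartz n) (h0 : φ.1 0 = 0) : (A φ).1 0 = 0 := by
  have hcont : ∀ x : Fin n → ℚ_[2],
      IsOpen {y : Fin n → ℚ_[2] | ψ (-(2 * ∑ i, x i * y i)) = -1} := fun x =>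
    (hψ.isLocallyConstant.comp_continuous
      (f := fun y : Fin n → ℚ_[2] => -(2 * ∑ i, x i * y i)) (by fun_prop)).isOpen_fiber (-1)
  have hclosed : tsupport φ.1 = Function.support φ.1 :=
    (show IsClosed (φ.1 ⁻¹' {0}ᶜ) from (φ.2.1.isClopen_fiber 0).compl.isClosed).closure_eq
  obtain ⟨s, hs⟩ := (show IsCompact (tsupport φ.1) from φ.2.2).elim_finite_subcover _ hcont
    fun y hy => by
      rw [hclosed] at hy
      obtain ⟨i, hi⟩ : ∃ i, y i ≠ 0 := by
        by_contra! hcon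
        exact hy (by rwa [show y = 0 from funext hcon])
      refine Set.mem_iUnion.2 ⟨Pi.single i (-(2 * y i)⁻¹), ?_⟩
      have : -(2 * ∑ j, (Pi.single i (-(2 * y i)⁻¹) : Fin n → ℚ_[2]) j * y j) = 1 := by
        rw [Finset.sum_eq_single i (fun j _ hj => by simp [hj]) (by simp)]
        simp only [Pi.single_eq_same]
        field_simp
      simp only [Set.mem_ofPred_eq, this, hψ.map_one]
  refine apply_zero_eq_zero_of_finset hψ A hA s φ fun y hy => ?_
  obtain ⟨x, hx, h⟩ := Set.mem_iUnion₂.1 (hs (subset_tsupport _ hy))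
  exact ⟨x, hx, h⟩

theorem fzero_apply_of_integral {y : Fin n → ℚ_[2]} (hy : ∀ i, ‖y i‖ ≤ 1) :
    (fzero n).1 y = 1 :=
  (Finset.prod_eq_one fun i _ => if_pos (by simpa using hy i) : ∏ i, phi 0 (y i) = 1)

theorem fzero_apply_of_not_integral {y : Fin n → ℚ_[2]} (hy : ¬ ∀ i, ‖y i‖ ≤ 1) :
    (fzero n).1 y = 0 := by
  obtain ⟨i, hi⟩ := not_forall.1 hy
  exact Finset.prod_eq_zero (Finset.mem_univ i) (if_neg (by simpa using hi))

theorem fzero_apply_zero : (fzero n).1 0 = 1 :=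
  fzero_apply_of_integral (by simp)

theorem fzero_ne_zero : fzero n ≠ 0 := fun h => by
  have := fzero_apply_zero (n := n)
  rw [h] at this
  exact zero_ne_one this

/-- Schur's lemma for the Schrödinger representation. -/
theorem exists_eq_smul_of_commute (hψ : HasConductor ψ 1) (A : Schwartz n →ₗ[ℂ] Schwartz n)
    (hA : ∀ a φ, A (schrodinger n hψ a φ) = schrodinger n hψ a (A φ)) :
    ∃ c : ℂ, ∀ φ y, (A φ).1 y = c * φ.1 y := by
  -- As `f(0) = 1`, translating `φ` by `y` and subtracting `φ(y) f` gives a function vanishing at 0.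
  refine ⟨(A (fzero n)).1 0, fun φ y => ?_⟩
  have h := apply_zero_eq_zero hψ A hA
    (schrodinger n hψ ⟨Sum.elim 0 y, 0⟩ φ - φ.1 y • fzero n) (by
      change (schrodinger n hψ ⟨Sum.elim 0 y, 0⟩ φ).1 0 - φ.1 y * (fzero n).1 0 = 0
      rw [schrodinger_inr, fzero_apply_zero, add_zero, mul_one, sub_self])
  rw [map_sub, map_smul, hA] at h
  change (schrodinger n hψ ⟨Sum.elim 0 y, 0⟩ (A φ)).1 0 - φ.1 y * (A (fzero n)).1 0 = 0 at h
  rw [schrodinger_inr, add_zero, sub_eq_zero] at h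
  rw [h, mul_comm]

/-! ### The vector `f` -/

/-- A function supported on `ℤ_2 ^ n` and invariant under `ℤ_2 ^ n` is a multiple of `f`. -/
theorem eq_smul_fzero {θ : Schwartz n} (hsupp : ∀ y, θ.1 y ≠ 0 → ∀ i, ‖y i‖ ≤ 1)
    (hinv : ∀ x, (∀ i, ‖x i‖ ≤ 1) → θ.1 x = θ.1 0) : θ = θ.1 0 • fzero n := by
  ext y
  change θ.1 y = θ.1 0 * (fzero n).1 y
  by_cases hy : ∀ i, ‖y i‖ ≤ 1
  · rw [fzero_apply_of_integral hy, hinv y hy, mul_one]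
  · rw [fzero_apply_of_not_integral hy, mul_zero]
    by_contra h
    exact hy (hsupp y h)

/-- The quadratic form `q(x, y) = ∑ x_i y_i`. -/
def quad {R : Type*} [CommRing R] (v : Fin n ⊕ Fin n → R) : R :=
  ∑ i, v (Sum.inl i) * v (Sum.inr i)

theorem norm_sum_le_of_forall {ι : Type*} (s : Finset ι) (f : ι → ℚ_[2]) {C : ℝ} (hC : 0 ≤ C)
    (h : ∀ i ∈ s, ‖f i‖ ≤ C) : ‖∑ i ∈ s, f i‖ ≤ C :=
  IsUltrametricDist.norm_sum_le_of_forall_le_of_nonneg hC h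

/-- The lattice `ℤ_2 ^ 2n` acts on `f` through a character. -/
theorem schrodinger_fzero (hψ : HasConductor ψ 1) {v : SympSpace n} (hv : ∀ k, ‖v k‖ ≤ 1) :
    schrodinger n hψ ⟨v, 0⟩ (fzero n) = ψ (-quad v) • fzero n := by
  ext y
  change (schrodinger n hψ ⟨v, 0⟩ (fzero n)).1 y = ψ (-quad v) * (fzero n).1 y
  rw [schrodinger_apply]
  have hiff : (∀ i, ‖v (Sum.inr i) + y i‖ ≤ 1) ↔ ∀ i, ‖y i‖ ≤ 1 := by
    refine forall_congr' fun i => ⟨fun h => ?_, fun h => ?_⟩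
    · have := padic_norm_sub_le_max (v (Sum.inr i) + y i) (v (Sum.inr i))
      rw [add_sub_cancel_left] at this
      exact this.trans (max_le h (hv _))
    · exact (IsUltrametricDist.norm_add_le_max _ _).trans (max_le (hv _) h)
  by_cases hy : ∀ i, ‖y i‖ ≤ 1
  · rw [fzero_apply_of_integral (hiff.2 hy), fzero_apply_of_integral hy]
    congr 1
    refine hψ.map_eq_of_sub ?_
    have e : (0 : ℚ_[2]) - ∑ i, v (Sum.inl i) * (v (Sum.inr i) + 2 * y i) - -quad v
        = ∑ i, -(2 * (v (Sum.inl i) * y i)) := by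
      simp only [quad, mul_add, Finset.sum_add_distrib, Finset.sum_neg_distrib]
      rw [show ∑ i, v (Sum.inl i) * (2 * y i) = ∑ i, 2 * (v (Sum.inl i) * y i) from
        Finset.sum_congr rfl fun i _ => by ring]
      ring
    change ‖(0 : ℚ_[2]) - _ - _‖ ≤ _
    rw [e]
    refine norm_sum_le_of_forall _ _ (by norm_num) fun i _ => ?_
    rw [norm_neg, norm_mul, norm_mul, norm_two]
    have := mul_le_mul (hv (Sum.inl i)) (hy i) (norm_nonneg _) zero_le_one
    linarith
  · rw [fzero_apply_of_not_integral hy, fzero_apply_of_not_integral (fun h => hy (hiff.1 h)),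
      mul_zero, mul_zero]

theorem norm_le_one_of_schrodinger_inl (hψ : HasConductor ψ 1) {θ : Schwartz n}
    (h : ∀ x : Fin n → ℚ_[2], (∀ i, ‖x i‖ ≤ 1) → schrodinger n hψ ⟨Sum.elim x 0, 0⟩ θ = θ)
    (y : Fin n → ℚ_[2]) (hy : θ.1 y ≠ 0) (i : Fin n) : ‖y i‖ ≤ 1 := by
  have h2 : ‖2 * y i‖ ≤ 1 / 2 := hψ.norm_le_half_of_forall fun x hx => by
    have := congrArg (fun φ : Schwartz n => φ.1 y) (h (Pi.single i (-x)) fun j => by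
      rcases eq_or_ne j i with rfl | hj
      · simpa using hx
      · simp [hj])
    simp only [schrodinger_inl] at this
    rw [Finset.sum_eq_single i (fun j _ hj => by simp [hj]) (by simp)] at this
    have := mul_right_cancel₀ hy (this.trans (one_mul _).symm)
    rw [← this]
    congr 1
    simp only [Pi.single_eq_same]
    ring
  rw [norm_mul, norm_two] at h2
  linarith

theorem schrodinger_inl_eq_self (hψ : HasConductor ψ 1) {θ : Schwartz n}
    (h : ∀ y, θ.1 y ≠ 0 → ∀ i, ‖y i‖ ≤ 1) (x : Fin n → ℚ_[2]) (hx : ∀ i, ‖x i‖ ≤ 1) :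
    schrodinger n hψ ⟨Sum.elim x 0, 0⟩ θ = θ := by
  ext y
  rw [schrodinger_inl]
  by_cases hy : θ.1 y = 0
  · rw [hy, mul_zero]
  · rw [hψ.map_eq_one, one_mul]
    rw [norm_neg, norm_mul, norm_two]
    have := norm_sum_le_of_forall Finset.univ (fun i => x i * y i) zero_le_one fun i _ => by
      rw [norm_mul]
      exact mul_le_one₀ (hx i) (norm_nonneg _) (h y hy i)
    linarith

/-- The vectors on which the lattice acts as on `f` are the multiples of `f`. -/
theorem eq_smul_fzero_of_schrodinger (hψ : HasConductor ψ 1) {θ : Schwartz n}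
    (h : ∀ v : SympSpace n, (∀ k, ‖v k‖ ≤ 1) → schrodinger n hψ ⟨v, 0⟩ θ = ψ (-quad v) • θ) :
    θ = θ.1 0 • fzero n := by
  refine eq_smul_fzero (norm_le_one_of_schrodinger_inl hψ fun x hx => ?_) fun x hx => ?_
  · rw [h _ (by rintro (i | i) <;> simp [hx])]
    simp [quad]
  · have := congrArg (fun φ : Schwartz n => φ.1 0)
      (h (Sum.elim 0 x) (by rintro (i | i) <;> simp [hx]))
    simp only [schrodinger_inr, add_zero] at this
    simpa [quad] using this

end Schrodinger

/-! ### Root elements and their lifts -/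

section Roots

variable {n : ℕ} {R : Type*} [CommRing R]

theorem Root.coe_elt (α : Root n) (t : R) : (α.elt t).1 = 1 + t • α.X R := rfl

theorem Root.X_mul_X (α : Root n) : α.X R * α.X R = 0 := by
  cases α with
  | sub i j h => simp [Root.X, fromBlocks_multiply, h, h.symm]
  | add i j h => simp [Root.X, fromBlocks_multiply]
  | negAdd i j h => simp [Root.X, fromBlocks_multiply]
  | long i => simp [Root.X, fromBlocks_multiply]
  | negLong i => simp [Root.X, fromBlocks_multiply]

theorem Root.elt_add (α : Root n) (s t : R) : α.elt (s + t) = α.elt s * α.elt t := by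
  refine Subtype.ext ?_
  change 1 + (s + t) • α.X R = (1 + s • α.X R) * (1 + t • α.X R)
  simp only [add_mul, mul_add, one_mul, mul_one, smul_mul_assoc, mul_smul_comm, α.X_mul_X,
    smul_zero, add_zero, add_smul]
  abel

theorem Root.elt_zero (α : Root n) : α.elt (0 : R) = 1 := by
  refine Subtype.ext ?_
  simp [Root.coe_elt]

theorem Root.map_X {S : Type*} [CommRing S] (f : R →+* S) (α : Root n) :
    (α.X R).map f = α.X S := by
  cases α <;>
    simp [Root.X, fromBlocks_map, Matrix.map_single, Matrix.map_neg, Matrix.map_add]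

theorem Root.sympMap_elt {S : Type*} [CommRing S] (f : R →+* S) (α : Root n) (t : R) :
    sympMap n f (α.elt t) = α.elt (f t) := by
  refine Subtype.ext ?_
  change (1 + t • α.X R).map f = 1 + f t • α.X S
  rw [Matrix.map_add _ (map_add f), Matrix.map_one _ (map_zero f) (map_one f),
    Matrix.map_smul' _ _ _ (map_mul f), α.map_X]

theorem Root.long_elt_mulVec (i : Fin n) (t : R) (v : Fin n ⊕ Fin n → R) :
    ((Root.long i).elt t).1 *ᵥ v =
      v + Sum.elim (Pi.single i (t * v (Sum.inr i))) 0 := by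
  rw [Root.coe_elt, add_mulVec, one_mulVec, smul_mulVec, Root.X, fromBlocks_mulVec]
  congr 1
  ext (k | k)
  · simp [single_mulVec_eq, Pi.single_apply]
  · simp

theorem symJ_mulVec (v : Fin n ⊕ Fin n → R) :
    (SymplecticGroup.symJ (Fin n) R).1 *ᵥ v =
      Sum.elim (fun i => -v (Sum.inr i)) (fun i => v (Sum.inl i)) := by
  change Matrix.J (Fin n) R *ᵥ v = _
  rw [Matrix.J, fromBlocks_mulVec]
  ext (k | k) <;> simp [neg_mulVec]

theorem symJ_mul_negLong (i : Fin n) (t : R) :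
    SymplecticGroup.symJ (Fin n) R * (Root.negLong i).elt t =
      (Root.long i).elt (-t) * SymplecticGroup.symJ (Fin n) R := by
  refine Subtype.ext ?_
  change Matrix.J (Fin n) R * (1 + t • _) = (1 + (-t) • _) * Matrix.J (Fin n) R
  simp [mul_add, add_mul, Root.X, Matrix.J, fromBlocks_multiply, fromBlocks_smul, fromBlocks_neg]

/-- The element `diag(2, 1/2)` of the symplectic group. -/
def dilElt (n : ℕ) : symplecticGroup (Fin n) ℚ_[2] :=
  ⟨fromBlocks ((2 : ℚ_[2]) • 1) 0 0 ((2⁻¹ : ℚ_[2]) • 1), by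
    rw [SymplecticGroup.mem_iff, Matrix.J]
    simp [fromBlocks_transpose, fromBlocks_multiply]⟩

theorem dilElt_mulVec (v : SympSpace n) :
    (dilElt n).1 *ᵥ v =
      Sum.elim (fun i => 2 * v (Sum.inl i)) (fun i => 2⁻¹ * v (Sum.inr i)) := by
  rw [dilElt, fromBlocks_mulVec]
  ext (k | k) <;> simp [smul_mulVec]

theorem dilElt_mul_long (i : Fin n) (t : ℚ_[2]) :
    dilElt n * (Root.long i).elt t = (Root.long i).elt (4 * t) * dilElt n := by
  refine Subtype.ext ?_
  change fromBlocks ((2 : ℚ_[2]) • 1) 0 0 ((2⁻¹ : ℚ_[2]) • 1) * (1 + t • _) =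
    (1 + (4 * t) • _) * fromBlocks ((2 : ℚ_[2]) • 1) 0 0 ((2⁻¹ : ℚ_[2]) • 1)
  simp only [mul_add, add_mul, mul_one, one_mul, Root.X, fromBlocks_multiply, fromBlocks_smul,
    smul_zero, smul_mul_assoc, mul_smul_comm, mul_zero, zero_mul, zero_add, add_zero, smul_smul]
  congr 3
  ring

end Roots

/-! ### Lifting root groups through a two-fold central extension. -/

section Lifts

variable {n : ℕ} {G : Type*} [Group G] {π : G →* symplecticGroup (Fin n) ℚ_[2]}

namespace IsTwoFoldCentralExtension

theorem mul_self_eq (hπ : IsTwoFoldCentralExtension π) {a b : G} (h : π a = π b) :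
    a * a = b * b := by
  have hz : a * b⁻¹ ∈ π.ker := by rw [MonoidHom.mem_ker, map_mul, map_inv, h, mul_inv_cancel]
  have h2 : (a * b⁻¹) * (a * b⁻¹) = 1 := by
    have := pow_card_eq_one' (x := (⟨_, hz⟩ : π.ker))
    rw [hπ.card_ker, pow_two] at this
    exact congrArg Subtype.val this
  have hc := Subgroup.mem_center_iff.1 (hπ.central hz) b
  calc a * a = (a * b⁻¹) * (b * (a * b⁻¹)) * b := by group
    _ = ((a * b⁻¹) * (a * b⁻¹)) * (b * b) := by rw [hc]; group
    _ = b * b := by rw [h2, one_mul]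

/-- Up to a central factor, `b` is a square `c * c` with `c` over `1 + (t/2) X_α`. Conjugating `c`
by `a` gives another lift of the same element, hence the same square. -/
theorem commute_of_lifts (hπ : IsTwoFoldCentralExtension π) (α : Root n) {s t : ℚ_[2]} {a b : G}
    (ha : π a = α.elt s) (hb : π b = α.elt t) : Commute a b := by
  obtain ⟨c, hc⟩ := hπ.surjective (α.elt (t / 2))
  have h1 : Commute a (c * c) := by
    have := hπ.mul_self_eq (a := a * c * a⁻¹) (b := c) (by
      rw [map_mul, map_mul, map_inv, ha, hc, ← Root.elt_add, add_comm, Root.elt_add,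
        mul_inv_cancel_right])
    rw [Commute, SemiconjBy]
    nth_rewrite 2 [← this]
    group
  have hz : b * (c * c)⁻¹ ∈ π.ker := by
    rw [MonoidHom.mem_ker, map_mul, map_inv, map_mul, hb, hc, ← Root.elt_add, add_halves,
      mul_inv_cancel]
  have h2 : Commute a (b * (c * c)⁻¹) := Subgroup.mem_center_iff.1 (hπ.central hz) a
  have h3 := h2.mul_right h1
  rwa [inv_mul_cancel_right] at h3

/-- The lift of a root group to a two-fold central extension. -/
def rootLift (hπ : IsTwoFoldCentralExtension π) (α : Root n) : Multiplicative ℚ_[2] →* G where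
  toFun t :=
    (hπ.surjective (α.elt (t.toAdd / 2))).choose * (hπ.surjective (α.elt (t.toAdd / 2))).choose
  map_one' := by
    rw [hπ.mul_self_eq (b := 1), mul_one]
    rw [(hπ.surjective _).choose_spec, π.map_one, toAdd_one, zero_div, Root.elt_zero]
  map_mul' s t := by
    have hs := (hπ.surjective (α.elt (s.toAdd / 2))).choose_spec
    have ht := (hπ.surjective (α.elt (t.toAdd / 2))).choose_spec
    rw [hπ.mul_self_eq (b := (hπ.surjective (α.elt (s.toAdd / 2))).choose *
      (hπ.surjective (α.elt (t.toAdd / 2))).choose)]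
    · exact (hπ.commute_of_lifts α ht hs).mul_mul_mul_comm _ _
    · rw [(hπ.surjective _).choose_spec, π.map_mul, hs, ht, ← Root.elt_add, toAdd_mul, add_div]

theorem isRootLift_rootLift (hπ : IsTwoFoldCentralExtension π) : IsRootLift π hπ.rootLift := by
  intro α t
  have h := (hπ.surjective (α.elt (t / 2))).choose_spec
  change π (_ * _) = _
  rw [map_mul]
  refine (congrArg₂ (· * ·) h h).trans ?_
  rw [← Root.elt_add, add_halves]

end IsTwoFoldCentralExtension

theorem ofAdd_half_mul (x : Multiplicative ℚ_[2] →* G) (t : ℚ_[2]) :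
    x (.ofAdd t) = x (.ofAdd (t / 2)) * x (.ofAdd (t / 2)) := by
  rw [← map_mul, ← ofAdd_add, add_halves]

theorem IsRootLift.unique (hπ : IsTwoFoldCentralExtension π)
    {x x' : Root n → (Multiplicative ℚ_[2] →* G)} (hx : IsRootLift π x) (hx' : IsRootLift π x') :
    x' = x := by
  funext α
  refine MonoidHom.ext fun t => ?_
  induction t using Multiplicative.ofAdd.surjective.forall.2 with | _ t => ?_
  rw [ofAdd_half_mul (x' α), ofAdd_half_mul (x α)]
  exact hπ.mul_self_eq (by rw [hx, hx'])

/-- Conjugation relations in the symplectic group lift without a sign, because squaring the relation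
for half the parameters removes the kernel ambiguity. -/
theorem IsRootLift.conj (hπ : IsTwoFoldCentralExtension π)
    {x : Root n → (Multiplicative ℚ_[2] →* G)} (hx : IsRootLift π x) {h : G} {α β : Root n}
    {s t : ℚ_[2]} (he : π h * α.elt (s / 2) = β.elt (t / 2) * π h) :
    h * x α (.ofAdd s) = x β (.ofAdd t) * h := by
  have := hπ.mul_self_eq (a := h * x α (.ofAdd (s / 2)) * h⁻¹) (b := x β (.ofAdd (t / 2))) (by
    rw [map_mul, map_mul, map_inv, hx, hx, he, mul_inv_cancel_right])
  rw [ofAdd_half_mul (x α), ofAdd_half_mul (x β), ← this]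
  group

end Lifts

/-! ### Action of the Weil representation on long root elements -/

section Weil

variable {n : ℕ} {ψ : AddChar ℚ_[2] ℂ}

/-- Multiplication by `y ↦ ψ(t y_i²)`. -/
def mulGauss {c : ℤ} (hψ : HasConductor ψ c) (i : Fin n) (t : ℚ_[2]) :
    Schwartz n →ₗ[ℂ] Schwartz n where
  toFun φ := ⟨fun y => ψ (t * y i ^ 2) * φ.1 y,
    (hψ.isLocallyConstant.comp_continuous (f := fun y : Fin n → ℚ_[2] => t * y i ^ 2)
      (by fun_prop)).mul φ.2.1, φ.2.2.mul_left⟩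
  map_add' φ φ' := by
    ext y
    exact mul_add _ _ _
  map_smul' z φ := by
    ext y
    exact mul_left_comm _ _ _

/-- The operator `φ(y) ↦ φ(y / 2)`. -/
def dilate (n : ℕ) : Schwartz n →ₗ[ℂ] Schwartz n where
  toFun φ := ⟨fun y => φ.1 ((2⁻¹ : ℚ_[2]) • y),
    φ.2.1.comp_continuous (f := fun y : Fin n → ℚ_[2] => (2⁻¹ : ℚ_[2]) • y) (by fun_prop),
    φ.2.2.comp_homeomorph (Homeomorph.smulOfNeZero (2⁻¹ : ℚ_[2]) (by norm_num))⟩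
  map_add' _ _ := rfl
  map_smul' _ _ := rfl

/-- Multiplication by the inverse Gaussian undoes the twist by `1 + t X_{2λ_i}`, so its composite
with `ω(g)`, for `g` over that element, lies in the commutant of `ρ`. -/
theorem mulGauss_schrodinger {c : ℤ} (hψ : HasConductor ψ c) (i : Fin n) (t : ℚ_[2])
    (a : Heisenberg n) (θ : Schwartz n) :
    mulGauss hψ i (-t) (schrodinger n hψ (Heisenberg.act ((Root.long i).elt t) a) θ) =
      schrodinger n hψ a (mulGauss hψ i (-t) θ) := by
  ext y
  change ψ (-t * y i ^ 2) * (schrodinger n hψ _ θ).1 y = (schrodinger n hψ a _).1 y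
  rw [schrodinger_apply, schrodinger_apply]
  change _ = _ * (ψ (-t * _ ^ 2) * θ.1 _)
  rw [← mul_assoc, ← mul_assoc, ← AddChar.map_add_eq_mul, ← AddChar.map_add_eq_mul]
  simp only [Heisenberg.act, Root.long_elt_mulVec]
  congr 2
  · simp only [Pi.add_apply, Sum.elim_inl, Sum.elim_inr, Pi.zero_apply, add_zero, add_mul,
      Finset.sum_add_distrib]
    rw [Finset.sum_eq_single (f := fun j => (Pi.single i (t * a.vec (Sum.inr i)) :
      Fin n → ℚ_[2]) j * (a.vec (Sum.inr j) + 2 * y j)) i (fun j _ hj => by simp [hj]) (by simp)]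
    simp only [Pi.single_eq_same]
    ring
  · simp

theorem dilate_apply (φ : Schwartz n) (y : Fin n → ℚ_[2]) :
    (dilate n φ).1 y = φ.1 ((2⁻¹ : ℚ_[2]) • y) := rfl

theorem dilate_schrodinger {c : ℤ} (hψ : HasConductor ψ c) (a : Heisenberg n) (θ : Schwartz n) :
    dilate n (schrodinger n hψ (Heisenberg.act (dilElt n) a) θ) =
      schrodinger n hψ a (dilate n θ) := by
  refine Subtype.ext (funext fun y => ?_)
  rw [dilate_apply, schrodinger_apply, schrodinger_apply, dilate_apply]
  simp only [Heisenberg.act, dilElt_mulVec, Sum.elim_inl, Sum.elim_inr]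
  congr 2
  · congr 1
    refine Finset.sum_congr rfl fun i _ => ?_
    simp only [Pi.smul_apply, smul_eq_mul]
    field_simp
  · refine congrArg θ.1 (funext fun i => ?_)
    simp [mul_add]

variable {G : Type*} [Group G] {π : G →* symplecticGroup (Fin n) ℚ_[2]}
  {hψ : HasConductor ψ 1} {ω : Representation ℂ G (Schwartz n)}

theorem IsWeilRepresentation.apply (hω : IsWeilRepresentation hψ π ω) (g : G) (a : Heisenberg n)
    (φ : Schwartz n) :
    ω g (schrodinger n hψ a φ) = schrodinger n hψ (Heisenberg.act (π g) a) (ω g φ) :=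
  LinearMap.congr_fun (hω g a) φ

theorem rep_mul_apply (ω : Representation ℂ G (Schwartz n)) (a b : G) (φ : Schwartz n) :
    ω (a * b) φ = ω a (ω b φ) := by
  rw [map_mul]
  rfl

theorem rep_ne_zero (ω : Representation ℂ G (Schwartz n)) (g : G) {φ : Schwartz n} (h : φ ≠ 0) :
    ω g φ ≠ 0 := fun h0 => h <| by
  rw [← ω.inv_self_apply g φ, h0, map_zero]

theorem exists_long_apply (hω : IsWeilRepresentation hψ π ω) {i : Fin n} {t : ℚ_[2]} {g : G}
    (hg : π g = (Root.long i).elt t) :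
    ∃ c : ℂ, ∀ φ y, (ω g φ).1 y = c * (ψ (t * y i ^ 2) * φ.1 y) := by
  obtain ⟨c, hc⟩ := exists_eq_smul_of_commute hψ (mulGauss hψ i (-t) ∘ₗ ω g) fun a φ => by
    rw [LinearMap.comp_apply, hω.apply, hg, mulGauss_schrodinger, LinearMap.comp_apply]
  refine ⟨c, fun φ y => ?_⟩
  have h : ψ (-t * y i ^ 2) * (ω g φ).1 y = c * φ.1 y := hc φ y
  rw [mul_left_comm, ← h, ← mul_assoc, ← AddChar.map_add_eq_mul]
  simp

theorem exists_dilate_apply (hω : IsWeilRepresentation hψ π ω) {g : G} (hg : π g = dilElt n) :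
    ∃ c : ℂ, ∀ φ y, (ω g φ).1 ((2⁻¹ : ℚ_[2]) • y) = c * φ.1 y :=
  exists_eq_smul_of_commute hψ (dilate n ∘ₗ ω g) fun a φ => by
    rw [LinearMap.comp_apply, hω.apply, hg, dilate_schrodinger, LinearMap.comp_apply]

/-- The lift of a long root group acts by multiplication by a Gaussian. -/
theorem long_apply (hπ : IsTwoFoldCentralExtension π) (hω : IsWeilRepresentation hψ π ω)
    {x : Root n → (Multiplicative ℚ_[2] →* G)} (hx : IsRootLift π x) (i : Fin n) (t : ℚ_[2])
    (φ : Schwartz n) (y : Fin n → ℚ_[2]) :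
    (ω (x (.long i) (.ofAdd t)) φ).1 y = ψ (t * y i ^ 2) * φ.1 y := by
  choose c hc using fun s : ℚ_[2] => exists_long_apply hω (hx (.long i) s)
  have hc0 : ∀ s, (ω (x (.long i) (.ofAdd s)) (fzero n)).1 0 = c s := fun s => by
    rw [hc, fzero_apply_zero]
    simp
  have hadd : ∀ s r, c (s + r) = c s * c r := fun s r => by
    rw [← hc0 (s + r), ofAdd_add, map_mul, rep_mul_apply, hc, hc0]
    simp
  have h00 : c 0 = 1 := by
    rw [← hc0, ofAdd_zero, map_one, map_one]
    exact fzero_apply_zero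
  -- Conjugation by a lift of `diag(2, 1/2)` sends the parameter `s` to `4s`; comparing values at 0
  -- removes the Gaussians.
  have hfour : ∀ s, c (4 * s) = c s := fun s => by
    obtain ⟨h, hh⟩ := hπ.surjective (dilElt n)
    obtain ⟨d, hd⟩ := exists_dilate_apply hω hh
    have hd0 : d ≠ 0 := by
      rintro rfl
      refine rep_ne_zero ω h (fzero_ne_zero (n := n)) ?_
      ext y
      have := hd (fzero n) ((2 : ℚ_[2]) • y)
      rw [smul_smul, inv_mul_cancel₀ two_ne_zero, one_smul, zero_mul] at this
      exact this
    have key := hx.conj hπ (h := h) (α := .long i) (β := .long i) (s := s) (t := 4 * s) (by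
      rw [hh, dilElt_mul_long, mul_div_assoc])
    have h1 := congrArg (fun g => (ω g (fzero n)).1 ((2⁻¹ : ℚ_[2]) • (0 : Fin n → ℚ_[2]))) key
    simp only [rep_mul_apply] at h1
    rw [hd, hc0, hc, hd, fzero_apply_zero] at h1
    simp only [smul_zero, Pi.zero_apply, ne_eq, OfNat.ofNat_ne_zero, not_false_eq_true, zero_pow,
      mul_zero, AddChar.map_zero_eq_one, one_mul, mul_one] at h1
    exact mul_left_cancel₀ hd0 (by rw [h1, mul_comm])
  have hone : c t = 1 := by
    -- Since `c` is multiplicative, `c(4s) = c(s)` gives `c(3s) = 1`; take `s = t/3`.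
    have h1 := hfour (t / 3)
    have e : 4 * (t / 3) = t + t / 3 := by ring
    rw [e, hadd] at h1
    have hne : c (t / 3) ≠ 0 := fun h0 => by
      have := hadd (t / 3) (-(t / 3))
      rw [add_neg_cancel, h00, h0, zero_mul] at this
      exact one_ne_zero this
    exact mul_right_cancel₀ hne (by rw [h1, one_mul])
  rw [hc, hone, one_mul]

end Weil

/-! ### The action of `J` on `f` -/

section GroupJ

variable {n : ℕ}

theorem quad_comp {R S : Type*} [CommRing R] [CommRing S] (f : R →+* S) (v : Fin n ⊕ Fin n → R) :
    quad (fun k => f (v k)) = f (quad v) := by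
  simp [quad]

theorem mulVec_of_mem_linJ {g : symplecticGroup (Fin n) ℚ_[2]} (hg : g ∈ linJ n) {v : SympSpace n}
    (hv : ∀ k, ‖v k‖ ≤ 1) :
    (∀ k, ‖(g.1 *ᵥ v) k‖ ≤ 1) ∧ ‖quad (g.1 *ᵥ v) - quad v‖ ≤ 1 / 2 := by
  obtain ⟨g', hg', rfl⟩ := hg
  obtain ⟨v, rfl⟩ : ∃ w : Fin n ⊕ Fin n → ℤ_[2],
      v = fun k => PadicInt.Coe.ringHom (p := 2) (w k) := ⟨fun k => ⟨v k, hv k⟩, rfl⟩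
  have e : (sympMap n (PadicInt.Coe.ringHom (p := 2)) g').1 *ᵥ
      (fun k => PadicInt.Coe.ringHom (p := 2) (v k)) =
      fun k => PadicInt.Coe.ringHom (p := 2) ((g'.1 *ᵥ v) k) := by
    funext k
    exact (RingHom.map_mulVec (PadicInt.Coe.ringHom (p := 2)) g'.1 v k).symm
  rw [e, quad_comp, quad_comp, ← map_sub]
  refine ⟨fun k => ((g'.1 *ᵥ v) k).2, (norm_coe_le_half_iff _).2 ?_⟩
  have hq := borelF2_le_orthF2 n hg' fun k => PadicInt.toZMod (v k)
  have e2 : (sympMap n (PadicInt.toZMod (p := 2)) g').1 *ᵥ (fun k => PadicInt.toZMod (v k)) =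
      fun k => PadicInt.toZMod ((g'.1 *ᵥ v) k) := by
    funext k
    exact (RingHom.map_mulVec (PadicInt.toZMod (p := 2)) g'.1 v k).symm
  rw [e2] at hq
  rw [map_sub, ← quad_comp, ← quad_comp, sub_eq_zero]
  exact hq

theorem coe_elt_mem_linJ {g : symplecticGroup (Fin n) ℤ_[2]}
    (hg : sympMap n (PadicInt.toZMod (p := 2)) g = 1) :
    sympMap n (PadicInt.Coe.ringHom (p := 2)) g ∈ linJ n :=
  ⟨g, by
    change sympMap n (PadicInt.toZMod (p := 2)) g ∈ borelF2 n
    rw [hg]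
    exact one_mem _, rfl⟩

theorem toZMod_two_mul (s : ℤ_[2]) : PadicInt.toZMod (2 * s) = 0 := by
  rw [map_mul, map_ofNat]
  exact mul_eq_zero_of_left rfl _

theorem elt_two_mul_mem_linJ (α : Root n) (s : ℤ_[2]) :
    α.elt (2 * (s : ℚ_[2])) ∈ linJ n := by
  have := coe_elt_mem_linJ (g := α.elt (2 * s)) (by
    rw [Root.sympMap_elt, toZMod_two_mul, Root.elt_zero])
  rw [Root.sympMap_elt, map_mul, map_ofNat] at this
  exact this

theorem conj_elt_two_mul_mem_linJ (α β : Root n) (s : ℤ_[2]) :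
    α.elt (-1) * β.elt (2 * (s : ℚ_[2])) * α.elt 1 ∈ linJ n := by
  have := coe_elt_mem_linJ (g := α.elt (-1) * β.elt (2 * s) * α.elt 1) (by
    rw [map_mul, map_mul, Root.sympMap_elt, Root.sympMap_elt, Root.sympMap_elt, toZMod_two_mul,
      Root.elt_zero, mul_one, ← Root.elt_add, ← map_add, neg_add_cancel, map_zero, Root.elt_zero])
  rw [map_mul, map_mul, Root.sympMap_elt, Root.sympMap_elt, Root.sympMap_elt, map_mul, map_ofNat,
    map_neg, map_one] at this
  exact this

variable {ψ : AddChar ℚ_[2] ℂ} {G : Type*} [Group G] {π : G →* symplecticGroup (Fin n) ℚ_[2]}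
  {hψ : HasConductor ψ 1} {ω : Representation ℂ G (Schwartz n)}

/-- Under the hypothesis `ω(g) f` has the same lattice character as `f`, and that character
determines the line of `f`. -/
theorem rep_fzero (hω : IsWeilRepresentation hψ π ω) {g : G}
    (h : ∀ v : SympSpace n, (∀ k, ‖v k‖ ≤ 1) → ∃ u : SympSpace n, (∀ k, ‖u k‖ ≤ 1) ∧
      (π g).1 *ᵥ u = v ∧ ψ (-quad u) = ψ (-quad v)) :
    ω g (fzero n) = (ω g (fzero n)).1 0 • fzero n := by
  refine eq_smul_fzero_of_schrodinger hψ fun v hv => ?_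
  obtain ⟨u, hu, rfl, hq⟩ := h v hv
  have := hω.apply g ⟨u, 0⟩ (fzero n)
  rw [schrodinger_fzero hψ hu, map_smul, hq] at this
  exact this.symm

theorem rep_groupJ_fzero (hω : IsWeilRepresentation hψ π ω) (j : groupJ π) :
    ω j (fzero n) = (ω j (fzero n)).1 0 • fzero n := by
  refine rep_fzero hω fun v hv => ?_
  obtain ⟨h1, h2⟩ := mulVec_of_mem_linJ (inv_mem j.2 : (π j)⁻¹ ∈ linJ n) hv
  refine ⟨_, h1, ?_, hψ.map_eq_of_sub ?_⟩
  · rw [mulVec_mulVec]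
    have : (π j).1 * ((π j)⁻¹).1 = 1 := congrArg Subtype.val (mul_inv_cancel (π j))
    rw [this, one_mulVec]
  · rw [neg_sub_neg, norm_sub_rev]
    exact h2

/-- The character through which `J` acts on `f`. -/
def charJ (hω : IsWeilRepresentation hψ π ω) : groupJ π →* ℂˣ :=
  MonoidHom.toHomUnits
    { toFun := fun j => (ω j (fzero n)).1 0
      map_one' := by
        rw [Subgroup.coe_one, map_one]
        exact fzero_apply_zero
      map_mul' := fun j k => by
        rw [Subgroup.coe_mul, rep_mul_apply, rep_groupJ_fzero hω k, map_smul]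
        change _ * (ω j (fzero n)).1 0 = _ * (_ * (fzero n).1 0)
        rw [fzero_apply_zero, mul_one, mul_comm] }

theorem rep_eq_charJ (hω : IsWeilRepresentation hψ π ω) (j : groupJ π) :
    ω j (fzero n) = (charJ hω j : ℂ) • fzero n :=
  rep_groupJ_fzero hω j

theorem charJ_eq_of (hω : IsWeilRepresentation hψ π ω) {j : groupJ π} {c : ℂ}
    (h : ω j (fzero n) = c • fzero n) : (charJ hω j : ℂ) = c :=
  smul_left_injective ℂ fzero_ne_zero ((rep_eq_charJ hω j).symm.trans h)

theorem rep_symJ_fzero (hω : IsWeilRepresentation hψ π ω) {w : G}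
    (hw : π w = SymplecticGroup.symJ (Fin n) ℚ_[2]) :
    ω w (fzero n) = (ω w (fzero n)).1 0 • fzero n := by
  refine rep_fzero hω fun v hv => ?_
  refine ⟨Sum.elim (fun i => v (Sum.inr i)) (fun i => -v (Sum.inl i)), ?_, ?_, ?_⟩
  · rintro (i | i) <;> simp [hv]
  · rw [hw, symJ_mulVec]
    ext (i | i) <;> simp
  · refine hψ.map_eq_of_sub ?_
    have e : quad (Sum.elim (fun i => v (Sum.inr i)) (fun i => -v (Sum.inl i))) = -quad v := by
      rw [quad, quad, ← Finset.sum_neg_distrib]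
      exact Finset.sum_congr rfl fun i _ => by
        rw [Sum.elim_inl, Sum.elim_inr]
        ring
    rw [e, sub_neg_eq_add, neg_neg, ← two_mul, norm_mul, norm_two]
    have : ‖quad v‖ ≤ 1 := norm_sum_le_of_forall _ _ zero_le_one fun i _ => by
      rw [norm_mul]
      exact mul_le_one₀ (hv _) (norm_nonneg _) (hv _)
    linarith

variable {x : Root n → (Multiplicative ℚ_[2] →* G)}

theorem rep_long_fzero (hπ : IsTwoFoldCentralExtension π) (hω : IsWeilRepresentation hψ π ω)
    (hx : IsRootLift π x) (i : Fin n) (s : ℤ_[2]) :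
    ω (x (.long i) (.ofAdd (2 * (s : ℚ_[2])))) (fzero n) = fzero n := by
  refine Subtype.ext (funext fun y => ?_)
  rw [long_apply hπ hω hx]
  by_cases hy : ∀ i, ‖y i‖ ≤ 1
  · rw [hψ.map_eq_one, one_mul]
    rw [norm_mul, norm_pow]
    have := mul_le_mul (norm_two_mul_coe_le s) (pow_le_one₀ (n := 2) (norm_nonneg _) (hy i))
      (by positivity) (by norm_num)
    simpa using this
  · rw [fzero_apply_of_not_integral hy, mul_zero]

/-! ### Negative long roots and the isotypic space. -/

theorem conj_symJ (hπ : IsTwoFoldCentralExtension π) (hx : IsRootLift π x) {w : G}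
    (hw : π w = SymplecticGroup.symJ (Fin n) ℚ_[2]) (i : Fin n) (t : ℚ_[2]) :
    w * x (.negLong i) (.ofAdd t) = x (.long i) (.ofAdd (-t)) * w :=
  hx.conj hπ (by rw [hw, symJ_mul_negLong, neg_div])

/-- Vectors of weight `x ↦ ψ(x²)` under the root line of `e_i` are supported on
`y_i ∈ 1/2 + ℤ_2`. -/
theorem norm_one_add_two_mul_le (hψ : HasConductor ψ 1) {θ : Schwartz n} {i : Fin n}
    (h : ∀ a : ℚ_[2], ‖a‖ ≤ 1 →
      schrodinger n hψ ⟨Sum.elim (Pi.single i a) 0, 0⟩ θ = ψ (a ^ 2) • θ)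
    {y : Fin n → ℚ_[2]} (hy : θ.1 y ≠ 0) : ‖1 + 2 * y i‖ ≤ 1 / 2 := by
  refine hψ.norm_le_half_of_forall fun a ha => ?_
  have h1 : (schrodinger n hψ ⟨Sum.elim (Pi.single i a) 0, 0⟩ θ).1 y = ψ (a ^ 2) * θ.1 y :=
    congrArg (fun φ : Schwartz n => φ.1 y) (h a ha)
  rw [schrodinger_inl, Finset.sum_eq_single i (fun j _ hj => by simp [hj]) (by simp)] at h1
  simp only [Pi.single_eq_same] at h1
  have h2 := mul_right_cancel₀ hy h1
  rw [hψ.map_sq ha] at h2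
  rw [show a * (1 + 2 * y i) = a + 2 * (a * y i) by ring, AddChar.map_add_eq_mul, ← h2,
    ← AddChar.map_add_eq_mul, neg_add_cancel, AddChar.map_zero_eq_one]

theorem rep_negLong (hπ : IsTwoFoldCentralExtension π) (hω : IsWeilRepresentation hψ π ω)
    (hx : IsRootLift π x) (i : Fin n) (s : ℤ_[2]) :
    ω (x (.negLong i) (.ofAdd (2 * (s : ℚ_[2])))) (ω (x (.long i) (.ofAdd 1)) (fzero n)) =
      ψ (-(2 * (s : ℚ_[2])) / 4) • ω (x (.long i) (.ofAdd 1)) (fzero n) := by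
  obtain ⟨w, hw⟩ := hπ.surjective (SymplecticGroup.symJ (Fin n) ℚ_[2])
  set g : G := w * x (.long i) (.ofAdd 1) with hg
  -- The vector `a e_i - a f_i` has `-q = a²`; `1 + X_{2λ_i}` sends it to `-a f_i`, and the matrix
  -- `J` sends that to `a e_i`.
  have hweight : ∀ a : ℚ_[2], ‖a‖ ≤ 1 →
      schrodinger n hψ ⟨Sum.elim (Pi.single i a) 0, 0⟩ (ω g (fzero n)) =
        ψ (a ^ 2) • ω g (fzero n) := fun a ha => by
    have key := hω.apply g ⟨Sum.elim (Pi.single i a) (Pi.single i (-a)), 0⟩ (fzero n)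
    rw [schrodinger_fzero hψ (by
      rintro (j | j) <;> rcases eq_or_ne j i with rfl | hj <;> simp [*]), map_smul] at key
    have hq : -quad (Sum.elim (Pi.single i a) (Pi.single i (-a)) : SympSpace n) = a ^ 2 := by
      rw [quad, Finset.sum_eq_single i (fun j _ hj => by simp [hj]) (by simp)]
      simp
      ring
    have hv : (π g).1 *ᵥ (Sum.elim (Pi.single i a) (Pi.single i (-a)) : SympSpace n) =
        Sum.elim (Pi.single i a) 0 := by
      rw [hg, map_mul, hw, hx]
      change (_ * _) *ᵥ _ = _
      rw [← mulVec_mulVec, Root.long_elt_mulVec, symJ_mulVec]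
      ext (j | j) <;> rcases eq_or_ne j i with rfl | hj <;> simp [*]
    rw [hq] at key
    rw [key, Heisenberg.act, hv]
  have hmain : ω (x (.long i) (.ofAdd (-(2 * (s : ℚ_[2]))))) (ω g (fzero n)) =
      ψ (-(2 * (s : ℚ_[2])) / 4) • ω g (fzero n) := by
    refine Subtype.ext (funext fun y => ?_)
    change _ = _ * (ω g (fzero n)).1 y
    rw [long_apply hπ hω hx]
    by_cases hy : (ω g (fzero n)).1 y = 0
    · rw [hy, mul_zero, mul_zero]
    · congr 1
      refine hψ.map_eq_of_sub ?_
      have h1 := norm_one_add_two_mul_le hψ hweight hy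
      have h2 : ‖1 + 2 * y i - 2‖ ≤ 1 / 2 :=
        (padic_norm_sub_le_max _ _).trans (max_le h1 norm_two.le)
      -- Here `4 y_i² - 1 = (2 y_i + 1)(2 y_i - 1)` has both factors in `2ℤ_2`, so half of it still
      -- lies in `2ℤ_2`.
      have e : -(2 * (s : ℚ_[2])) * y i ^ 2 - -(2 * (s : ℚ_[2])) / 4 =
          -(s : ℚ_[2]) * ((1 + 2 * y i) * (1 + 2 * y i - 2)) / 2 := by ring
      rw [e, norm_div, norm_mul, norm_neg, norm_two]
      have h3 : ‖(1 + 2 * y i) * (1 + 2 * y i - 2)‖ ≤ 1 / 2 * (1 / 2) := by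
        rw [norm_mul]
        exact mul_le_mul h1 h2 (norm_nonneg _) (by norm_num)
      have h4 : ‖(s : ℚ_[2])‖ * ‖(1 + 2 * y i) * (1 + 2 * y i - 2)‖ ≤ 1 * (1 / 2 * (1 / 2)) :=
        mul_le_mul s.2 h3 (norm_nonneg _) zero_le_one
      linarith
  have hconj : x (.long i) (.ofAdd (-(2 * (s : ℚ_[2])))) * g =
      w * (x (.negLong i) (.ofAdd (2 * (s : ℚ_[2]))) * x (.long i) (.ofAdd 1)) := by
    rw [hg, ← mul_assoc, ← conj_symJ hπ hx hw, mul_assoc]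
  rw [← rep_mul_apply, hconj, hg, rep_mul_apply ω w, rep_mul_apply ω w, ← map_smul] at hmain
  have := congrArg (ω w⁻¹) hmain
  rw [ω.inv_self_apply, ω.inv_self_apply, rep_mul_apply] at this
  exact this

/-- Vectors fixed by the long root elements of `Γ(2)` are supported on `ℤ_2 ^ n`. -/
theorem norm_le_one_of_long (hπ : IsTwoFoldCentralExtension π) (hω : IsWeilRepresentation hψ π ω)
    (hx : IsRootLift π x) {φ : Schwartz n}
    (h : ∀ (i : Fin n) (s : ℤ_[2]), ω (x (.long i) (.ofAdd (2 * (s : ℚ_[2])))) φ = φ)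
    (y : Fin n → ℚ_[2]) (hy : φ.1 y ≠ 0) (i : Fin n) : ‖y i‖ ≤ 1 := by
  have h1 : ‖2 * y i ^ 2‖ ≤ 1 / 2 := hψ.norm_le_half_of_forall fun a ha => by
    have := long_apply hπ hω hx i (2 * a) φ y
    have h' := h i ⟨a, ha⟩
    rw [h'] at this
    have := mul_right_cancel₀ hy (this.symm.trans (one_mul _).symm)
    rw [← this]
    congr 1
    ring
  rw [norm_mul, norm_two, norm_pow] at h1
  exact (pow_le_one_iff_of_nonneg (norm_nonneg _) two_ne_zero).1 (by linarith)

theorem isotypic_charJ (hπ : IsTwoFoldCentralExtension π) (hω : IsWeilRepresentation hψ π ω)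
    (hx : IsRootLift π x) :
    isotypic ω (groupJ π) (charJ hω) = Submodule.span ℂ {fzero n} := by
  refine le_antisymm (fun φ hφ => ?_) ?_
  · have hmem : ∀ (α : Root n) (s : ℤ_[2]), x α (.ofAdd (2 * (s : ℚ_[2]))) ∈ groupJ π :=
      fun α s => by
        change π _ ∈ linJ n
        rw [hx]
        exact elt_two_mul_mem_linJ α s
    have hfix : ∀ (i : Fin n) (s : ℤ_[2]), ω (x (.long i) (.ofAdd (2 * (s : ℚ_[2])))) φ = φ :=
      fun i s => by
        have := hφ ⟨_, hmem (.long i) s⟩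
        rwa [charJ_eq_of hω (c := 1) (by rw [one_smul]; exact rep_long_fzero hπ hω hx i s),
          one_smul] at this
    have hsupp := norm_le_one_of_long hπ hω hx hfix
    obtain ⟨w, hw⟩ := hπ.surjective (SymplecticGroup.symJ (Fin n) ℚ_[2])
    have hswap : ∀ (i : Fin n) (s : ℤ_[2]) (φ : Schwartz n),
        ω (x (.long i) (.ofAdd (2 * (s : ℚ_[2])))) (ω w φ) =
          ω w (ω (x (.negLong i) (.ofAdd (2 * ((-s : ℤ_[2]) : ℚ_[2])))) φ) := fun i s φ => by
      rw [← rep_mul_apply, ← rep_mul_apply, conj_symJ hπ hx hw]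
      simp
    -- The character is trivial on negative long roots too: `w` moves them to positive ones while
    -- preserving the line of `f`.
    have hneg : ∀ (i : Fin n) (s : ℤ_[2]),
        ω (x (.negLong i) (.ofAdd (2 * ((-s : ℤ_[2]) : ℚ_[2])))) (fzero n) = fzero n :=
      fun i s => by
        have h1 := hswap i s (fzero n)
        rw [rep_symJ_fzero hω hw, map_smul, rep_long_fzero hπ hω hx,
          ← rep_symJ_fzero hω hw] at h1
        have := congrArg (ω w⁻¹) h1
        rw [ω.inv_self_apply, ω.inv_self_apply] at this
        exact this.symm
    have hfix' : ∀ (i : Fin n) (s : ℤ_[2]),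
        ω (x (.long i) (.ofAdd (2 * (s : ℚ_[2])))) (ω w φ) = ω w φ := fun i s => by
      have := hφ ⟨_, hmem (.negLong i) (-s)⟩
      rw [charJ_eq_of hω (c := 1) (by rw [one_smul]; exact hneg i s), one_smul] at this
      rw [hswap]
      exact congrArg (ω w) this
    have hsupp' := norm_le_one_of_long hπ hω hx hfix'
    rw [eq_smul_fzero hsupp fun y hy => ?_]
    · exact Submodule.smul_mem _ _ (Submodule.mem_span_singleton_self _)
    -- The support of `ω(w)φ` makes it fixed by the integral vectors of `𝒳`. These are the images
    -- under `w` of the integral translations in `𝒴`, which therefore fix `φ`.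
    · have h1 := schrodinger_inl_eq_self hψ hsupp' (fun i => -y i) (by simpa using hy)
      have h2 := hω.apply w ⟨Sum.elim 0 y, 0⟩ φ
      have hv : Heisenberg.act (π w) ⟨Sum.elim 0 y, 0⟩ = ⟨Sum.elim (fun i => -y i) 0, 0⟩ := by
        rw [Heisenberg.act, hw, symJ_mulVec]
        congr 1
      rw [hv, h1] at h2
      have h3 := congrArg (ω w⁻¹) h2
      rw [ω.inv_self_apply, ω.inv_self_apply] at h3
      have h4 := schrodinger_inr hψ y φ 0
      rw [h3, add_zero] at h4
      exact h4.symm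
  · rw [Submodule.span_singleton_le_iff_mem]
    exact rep_eq_charJ hω

end GroupJ

end WeilType

end

open WeilType in
theorem mainTheorem4 (n : ℕ) (ψ : AddChar ℚ_[2] ℂ) (hψ : HasConductor ψ 1)
    {G : Type*} [Group G] (π : G →* Matrix.symplecticGroup (Fin n) ℚ_[2])
    (hπ : IsTwoFoldCentralExtension π)
    (ω : Representation ℂ G (Schwartz n)) (hω : IsWeilRepresentation hψ π ω) :
    -- the root elements have a unique lift to `G`
    ∃ x : Root n → (Multiplicative ℚ_[2] →* G),
      IsRootLift π x ∧ (∀ x', IsRootLift π x' → x' = x) ∧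
      -- `J` acts on `f` through a unique character `χ`
      ∃ χ : groupJ π →* ℂˣ,
        (∀ j : groupJ π, ω j (fzero n) = (χ j : ℂ) • fzero n) ∧
        (∀ χ' : groupJ π →* ℂˣ,
          (∀ j : groupJ π, ω j (fzero n) = (χ' j : ℂ) • fzero n) → χ' = χ) ∧
        (∀ (i : Fin n) (t : ℚ_[2]), (∃ s : ℤ_[2], t = 2 * (s : ℚ_[2])) →
          ∃ h : x (.long i) (.ofAdd t) ∈ groupJ π, χ ⟨_, h⟩ = 1) ∧
        (∀ (i : Fin n) (t : ℚ_[2]), (∃ s : ℤ_[2], t = 2 * (s : ℚ_[2])) →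
          ∃ h : x (.long i) (.ofAdd (-1)) * x (.negLong i) (.ofAdd t) * x (.long i) (.ofAdd 1)
              ∈ groupJ π,
            (χ ⟨_, h⟩ : ℂ) = ψ (-t / 4)) ∧
        isotypic ω (groupJ π) χ = Submodule.span ℂ {fzero n} := by
  have hx := hπ.isRootLift_rootLift
  refine ⟨hπ.rootLift, hx, fun x' hx' => hx.unique hπ hx', charJ hω, rep_eq_charJ hω,
    fun χ' h => MonoidHom.ext fun j => Units.ext (charJ_eq_of hω (h j)).symm, ?_, ?_,
    isotypic_charJ hπ hω hx⟩
  · rintro i _ ⟨s, rfl⟩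
    refine ⟨?_, Units.ext (charJ_eq_of hω ?_)⟩
    · change π _ ∈ linJ n
      rw [hx]
      exact elt_two_mul_mem_linJ _ s
    · rw [Units.val_one, one_smul]
      exact rep_long_fzero hπ hω hx i s
  · rintro i _ ⟨s, rfl⟩
    refine ⟨?_, charJ_eq_of hω ?_⟩
    · change π _ ∈ linJ n
      rw [map_mul, map_mul, hx, hx, hx]
      exact conj_elt_two_mul_mem_linJ _ _ s
    · rw [rep_mul_apply, rep_mul_apply, rep_negLong hπ hω hx, map_smul, ofAdd_neg, map_inv, ω.inv_self_apply]
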